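/- Let $\mathcal H=(L,R,E)$ be a finite block bipartite hypergraph: its vertex set is the disjoint union of $L$ and a linearly ordered set $R$, and every hyperedge $e\in E$ contains at most one vertex of $L$, while $e\cap R$ is a set of consecutive vertices of $R$ (the case $e\cap R=\emptyset$ is allowed). A matching is a set of pairwise disjoint hyperedges, and $P=P(\mathcal H)\subseteq[0,1]^E$ is the convex hull of the characteristic vectors of all matchings. For $x\in[0,1]^E$ let $\mathtt R(x)\subseteq E$ be the random set that contains each $e$ independently with probability $x_e$. For $b,c\in[0,1]$, a monotone $(b,c)$-balanced contention resolution scheme for $P$ is an assignment of a random set $\pi_x(A)\subseteq E$ to every $x\in bP=\{by : y\in P\}$ and every $A\subseteq E$, such that (1) $\pi_x(A)\subseteq A$ and $\pi_x(A)$ is a matching, always; (2) $\Pr[e\in\pi_x(A)]\ge\Pr[e\in\pi_x(B)]$ whenever $e\in A\subseteq B\subseteq E$; (3) $\Pr[e\in\pi_x(\mathtt R(x))]\ge c\,x_e$ for all $x\in bP$ and $e\in E$, where the randomness of $\mathtt R(x)$ is independent of that of $\pi$. **Lemma.** For every $b\in(0,1]$, every block bipartite hypergraph $\mathcal H$ admits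 a monotone $\bigl(b,\,e^{-b}(1-e^{-b})/b\bigr)$-balanced contention resolution scheme for $P(\mathcal H)$, and these schemes can be chosen to be efficiently computable: there is a single randomized algorithm (depending only on $b$, not on $\mathcal H$) which, given $\mathcal H$, integers $D\ge1$ and $a_e\ge0$ $(e\in E)$ such that $x=(a_e/D)_{e\in E}\in bP(\mathcal H)$, and a set $A\subseteq E$, outputs a random set with exactly the law of $\pi_x(A)$, and whose worst-case running time is polynomial in $|L|+|R|+|E|$ plus the total bit length of $D$ and the $a_e$. Here an algorithm is a program for a randomized random access machine with addition, truncated subtraction and comparison of natural numbers, array access, bounded loops, and sampling of a uniform element of $\{0,\dots,N-1\}$, each at unit cost. -/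

import Mathlib

/-- A block bipartite hypergraph with left vertices `Fin n`, right vertices `Fin r` (in this
order) and hyperedges listed as `Fin m`: every hyperedge contains at most one left vertex, and
its right vertices are consecutive. -/
structure BlockHypergraph (n r m : ℕ) where
  edge : Fin m → Finset (Fin n ⊕ Fin r)
  left_unique : ∀ e i j, Sum.inl i ∈ edge e → Sum.inl j ∈ edge e → i = j
  right_consecutive : ∀ e s t u, s ≤ t → t ≤ u →
    Sum.inr s ∈ edge e → Sum.inr u ∈ edge e → Sum.inr t ∈ edge e

namespace BlockHypergraph

variable {n r m : ℕ}

/-- A matching is a set of pairwise disjoint hyperedges. -/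
def IsMatching (H : BlockHypergraph n r m) (S : Finset (Fin m)) : Prop :=
  ∀ e ∈ S, ∀ f ∈ S, e ≠ f → Disjoint (H.edge e) (H.edge f)

/-- `i + 1` if `i` is the left vertex of the hyperedge `e`, and `0` if `e` has none. -/
def leftCode (H : BlockHypergraph n r m) (e : Fin m) : ℕ :=
  ∑ i : Fin n, if Sum.inl i ∈ H.edge e then (i : ℕ) + 1 else 0

/-- The index of the first right vertex of `e` (and `0` if `e` has none). -/
noncomputable def blockStart (H : BlockHypergraph n r m) (e : Fin m) : ℕ :=
  sInf {t : ℕ | ∃ h : t < r, Sum.inr ⟨t, h⟩ ∈ H.edge e}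

/-- The number of right vertices of `e`. -/
def blockLength (H : BlockHypergraph n r m) (e : Fin m) : ℕ :=
  (Finset.univ.filter fun t : Fin r => Sum.inr t ∈ H.edge e).card

/-- The left code determines the left vertices of a hyperedge. -/
theorem inl_mem_edge_iff (H : BlockHypergraph n r m) (e : Fin m) (i : Fin n) :
    Sum.inl i ∈ H.edge e ↔ H.leftCode e = i + 1 := by
  classical
  have key : ∀ j : Fin n, Sum.inl j ∈ H.edge e → H.leftCode e = j + 1 := by
    intro j hj
    unfold leftCode
    rw [Finset.sum_eq_single j]
    · simp [hj]
    · intro k _ hk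
      rw [if_neg]
      intro hk'
      exact hk (H.left_unique e k j hk' hj)
    · simp
  refine ⟨key i, fun h => ?_⟩
  by_cases hex : ∃ j : Fin n, Sum.inl j ∈ H.edge e
  · obtain ⟨j, hj⟩ := hex
    have hij : i = j := Fin.ext (by have := key j hj; omega)
    rwa [hij]
  · exfalso
    have h0 : H.leftCode e = 0 := by
      unfold leftCode
      refine Finset.sum_eq_zero fun k _ => if_neg fun hk => hex ⟨k, hk⟩
    omega

/-- The start and the length of the block determine the right vertices of a hyperedge. -/
theorem inr_mem_edge_iff (H : BlockHypergraph n r m) (e : Fin m) (t : Fin r) :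
    Sum.inr t ∈ H.edge e ↔
      H.blockStart e ≤ t ∧ (t : ℕ) < H.blockStart e + H.blockLength e := by
  classical
  set F : Finset ℕ :=
    (Finset.univ.filter fun t : Fin r => Sum.inr t ∈ H.edge e).map Fin.valEmbedding with hF
  have hcard : F.card = H.blockLength e := by simp [hF, blockLength]
  have hmem : ∀ k : ℕ, k ∈ F ↔ ∃ h : k < r, Sum.inr ⟨k, h⟩ ∈ H.edge e := by
    intro k
    simp only [hF, Finset.mem_map, Finset.mem_filter, Finset.mem_univ, true_and,
      Fin.valEmbedding_apply]
    constructor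
    · rintro ⟨a, ha, rfl⟩
      exact ⟨a.2, ha⟩
    · rintro ⟨h, hk⟩
      exact ⟨⟨k, h⟩, hk, rfl⟩
  have ht : Sum.inr t ∈ H.edge e ↔ (t : ℕ) ∈ F := by
    rw [hmem]
    exact ⟨fun h => ⟨t.2, h⟩, fun ⟨_, h⟩ => h⟩
  by_cases hne : F.Nonempty
  · obtain ⟨k0, hk0⟩ := hne
    have hs : H.blockStart e ∈ F := by
      rw [hmem]
      have hn : {t : ℕ | ∃ h : t < r, Sum.inr ⟨t, h⟩ ∈ H.edge e}.Nonempty :=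
        ⟨k0, (hmem k0).1 hk0⟩
      exact Nat.sInf_mem hn
    have hmin : ∀ k ∈ F, H.blockStart e ≤ k := fun k hk => Nat.sInf_le ((hmem k).1 hk)
    have hconv : ∀ k l, l ∈ F → H.blockStart e ≤ k → k ≤ l → k ∈ F := by
      intro k l hl h1 h2
      obtain ⟨hlr, hl'⟩ := (hmem l).1 hl
      obtain ⟨hsr, hs'⟩ := (hmem _).1 hs
      rw [hmem]
      exact ⟨lt_of_le_of_lt h2 hlr,
        H.right_consecutive e ⟨_, hsr⟩ ⟨k, lt_of_le_of_lt h2 hlr⟩ ⟨l, hlr⟩ h1 h2 hs' hl'⟩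
    have hFeq : F = Finset.Ico (H.blockStart e) (F.max' ⟨k0, hk0⟩ + 1) := by
      ext k
      rw [Finset.mem_Ico]
      constructor
      · intro hk
        exact ⟨hmin k hk, Nat.lt_succ_of_le (F.le_max' k hk)⟩
      · rintro ⟨h1, h2⟩
        exact hconv k _ (F.max'_mem ⟨k0, hk0⟩) h1 (Nat.le_of_lt_succ h2)
    have hc : H.blockLength e = F.max' ⟨k0, hk0⟩ + 1 - H.blockStart e := by
      rw [← hcard]
      conv_lhs => rw [hFeq]
      exact Nat.card_Ico _ _
    have hle := hmin _ (F.max'_mem ⟨k0, hk0⟩)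
    rw [ht, hFeq, Finset.mem_Ico]
    omega
  · rw [Finset.not_nonempty_iff_eq_empty] at hne
    have : H.blockLength e = 0 := by rw [← hcard, hne]; rfl
    rw [ht, hne, this]
    simp

end BlockHypergraph

/-- The convex hull of the characteristic vectors of the feasible subsets of `E`. -/
def feasiblePolytope {E : Type} [DecidableEq E] (feasible : Finset E → Prop) : Set (E → ℝ) :=
  convexHull ℝ {y | ∃ S, feasible S ∧ y = fun e => if e ∈ S then 1 else 0}

/-- The scaled set `b P = {b y | y ∈ P}`. -/
def scaledBy {E : Type} (b : ℝ) (P : Set (E → ℝ)) : Set (E → ℝ) :=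
  {x | ∃ y ∈ P, x = b • y}

/-- The probability that the random set with law `μ` contains `e`. -/
noncomputable def probMem {E : Type} (μ : PMF (Finset E)) (e : E) : ℝ :=
  (μ.toOuterMeasure {S | e ∈ S}).toReal

/-- The probability `Pr[R(x) = A]`, where the random set `R(x)` contains each `e`
independently with probability `x e`. -/
def roundingProb {E : Type} [Fintype E] [DecidableEq E] (x : E → ℝ) (A : Finset E) : ℝ :=
  ∏ e, if e ∈ A then x e else 1 - x e

/-- `π` is a monotone `(b, c)`-balanced contention resolution scheme for the convex hull of the
feasible sets; `π x A` is the law of the random set `π_x(A)`. Only the values of `π x` for `x`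
in `b P` matter. -/
structure IsMonotoneBalancedCRS {E : Type} [Fintype E] [DecidableEq E]
    (feasible : Finset E → Prop) (b c : ℝ) (π : (E → ℝ) → Finset E → PMF (Finset E)) :
    Prop where
  feasible_subset : ∀ x ∈ scaledBy b (feasiblePolytope feasible), ∀ A : Finset E,
    ∀ S ∈ (π x A).support, S ⊆ A ∧ feasible S
  monotone : ∀ x ∈ scaledBy b (feasiblePolytope feasible), ∀ A B : Finset E, A ⊆ B →
    ∀ e ∈ A, probMem (π x B) e ≤ probMem (π x A) e
  balanced : ∀ x ∈ scaledBy b (feasiblePolytope feasible), ∀ e : E,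
    c * x e ≤ ∑ A : Finset E, roundingProb x A * probMem (π x A) e

namespace RandomRAM

/-! A randomized random access machine over the natural numbers, programmed with bounded loops.
It has registers and arrays. Its arithmetic consists of addition and truncated subtraction, so
bit lengths grow by at most a constant (depending on the program) per step, and the unit-cost
step count below is polynomially related to bit operations. -/

/-- Contents of the registers and of the arrays. -/
structure State where
  reg : ℕ → ℕ
  arr : ℕ → ℕ → ℕ

def State.setReg (s : State) (v a : ℕ) : State :=
  { s with reg := Function.update s.reg v a }

def State.setArr (s : State) (k i a : ℕ) : State :=
  { s with arr := Function.update s.arr k (Function.update (s.arr k) i a) }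

/-- Expressions: constants, registers, array entries, sums, truncated differences. -/
inductive Expr where
  | const (a : ℕ)
  | reg (v : ℕ)
  | get (k : ℕ) (i : Expr)
  | add (p q : Expr)
  | sub (p q : Expr)

def Expr.eval (s : State) : Expr → ℕ
  | .const a => a
  | .reg v => s.reg v
  | .get k i => s.arr k (i.eval s)
  | .add p q => p.eval s + q.eval s
  | .sub p q => p.eval s - q.eval s

/-- Programs. `put k i p` writes the value of `p` to entry `i` of array `k`; `rand v p` puts a
uniformly random element of `{0, …, N - 1}` into register `v`, where `N` is the value of `p`;
`ifLt p q c d` runs `c` if `p < q` and `d` otherwise; `loop v p c` runs `c` with register `v` set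
to `0, 1, …, N - 1` in turn, where `N` is the value of `p` on entry. -/
inductive Program where
  | skip
  | set (v : ℕ) (p : Expr)
  | put (k : ℕ) (i p : Expr)
  | rand (v : ℕ) (p : Expr)
  | seq (c d : Program)
  | ifLt (p q : Expr) (c d : Program)
  | loop (v : ℕ) (p : Expr) (c : Program)

/-- The uniform law on `{0, …, N - 1}` (the point mass at `0` if `N = 0`). -/
noncomputable def uniformBelow : ℕ → PMF ℕ
  | 0 => PMF.pure 0
  | N + 1 => (PMF.uniformOfFintype (Fin (N + 1))).map Fin.val

/-- `N` rounds of a loop with counter `v`; the second component counts steps. -/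
noncomputable def loopRun (v : ℕ) (body : State → PMF (State × ℕ)) :
    ℕ → State → PMF (State × ℕ)
  | 0, s => PMF.pure (s, 1)
  | N + 1, s => (loopRun v body N s).bind fun z =>
      (body (z.1.setReg v N)).map fun w => (w.1, z.2 + w.2 + 1)

/-- The joint law of the final state and the number of steps. Every elementary command, every
test and every round of a loop is charged. -/
noncomputable def Program.run : Program → State → PMF (State × ℕ)
  | .skip, s => PMF.pure (s, 1)
  | .set v p, s => PMF.pure (s.setReg v (p.eval s), 1)
  | .put k i p, s => PMF.pure (s.setArr k (i.eval s) (p.eval s), 1)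
  | .rand v p, s => (uniformBelow (p.eval s)).map fun u => (s.setReg v u, 1)
  | .seq c d, s => (c.run s).bind fun z => (d.run z.1).map fun w => (w.1, z.2 + w.2)
  | .ifLt p q c d, s =>
      (if p.eval s < q.eval s then c.run s else d.run s).map fun w => (w.1, w.2 + 1)
  | .loop v p c, s => loopRun v c.run (p.eval s) s

/-- A function on `Fin m` as the content of an array, padded with zeros. -/
def toArray {m : ℕ} (g : Fin m → ℕ) (i : ℕ) : ℕ :=
  if h : i < m then g ⟨i, h⟩ else 0

/-- The initial state on the input consisting of the hypergraph `H`, the rational vector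
`x e = a e / D` and the set `A` of hyperedges. Registers `0`, `1`, `2`, `3` hold `n`, `r`, `m`,
`D`; arrays `0`, `1`, `2` describe the hyperedges, array `3` holds the numerators `a`, and
array `4` the indicator of `A`. Everything else is `0`. -/
noncomputable def initialState {n r m : ℕ} (H : BlockHypergraph n r m) (D : ℕ)
    (a : Fin m → ℕ) (A : Finset (Fin m)) : State where
  reg v :=
    match v with
    | 0 => n
    | 1 => r
    | 2 => m
    | 3 => D
    | _ => 0
  arr k :=
    match k with
    | 0 => toArray H.leftCode
    | 1 => toArray H.blockStart
    | 2 => toArray H.blockLength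
    | 3 => toArray a
    | 4 => toArray fun e => if e ∈ A then 1 else 0
    | _ => fun _ => 0

/-- The output is the set of hyperedges whose entry in array `5` is `1`. -/
def output (m : ℕ) (s : State) : Finset (Fin m) :=
  Finset.univ.filter fun e => s.arr 5 e = 1

/-- The size of the input: numbers of vertices and hyperedges plus the bit lengths of the
integers that describe the rational vector. -/
def inputSize (n r m D : ℕ) (a : Fin m → ℕ) : ℕ :=
  n + r + m + Nat.size D + ∑ e, Nat.size (a e)

/-- One program with polynomially bounded worst-case running time samples from the law
`π H x A`, for all block bipartite hypergraphs `H`, all rational `x` in `b P` and all sets `A`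
of hyperedges, where `P` is the convex hull of the matchings of `H`. -/
def EfficientlyComputable (b : ℝ)
    (π : ∀ n r m : ℕ, BlockHypergraph n r m →
      (Fin m → ℝ) → Finset (Fin m) → PMF (Finset (Fin m))) : Prop :=
  ∃ (c : Program) (q : Polynomial ℕ),
    ∀ (n r m : ℕ) (H : BlockHypergraph n r m) (D : ℕ) (a : Fin m → ℕ) (A : Finset (Fin m)),
      0 < D →
      (fun e => (a e : ℝ) / D) ∈ scaledBy b (feasiblePolytope H.IsMatching) →
      (∀ z ∈ (c.run (initialState H D a A)).support,
        z.2 ≤ q.eval (inputSize n r m D a)) ∧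
      (c.run (initialState H D a A)).map (fun z => output m z.1) =
        π n r m H (fun e => (a e : ℝ) / D) A

end RandomRAM

/-! The scheme first thins `A`: each hyperedge survives independently with probability `1 - x e /
2`, leaving a set `K`. Then `e ∈ K` is selected if no other member of `K` contains the first right
vertex of `e`, and if `e` wins a uniform draw among all members of `K` with the same left vertex,
blocked or not. Two consecutive blocks that meet have the property that one contains the first
vertex of the other, so the selected set is a matching (`isMatching_select`). Given `K`, the
selection probability of `e` is `1 / (k + 1)` if `e` is unblocked and `0` otherwise, with `k` the
number of left competitors. For fixed thinning this can only drop when `A` grows, which gives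
monotonicity.

For balance, `K` obtained from `R(x)` again has independent elements, with probabilities `x f * (1 -
x f / 2)`. Writing `1 / (k + 1) = ∫ t ^ k` over `[0, 1]` turns the selection probability into the
integral of a product over hyperedges. A blocker contributes at least `exp (-x f)`, and a left
competitor at least `exp (-(x f * (1 - t)))`. Membership in `b P` bounds by `b` both the `x`-mass of
the blockers together with `e` and that of the left competitors. The missing `x e` among the
blockers yields a factor `exp (x e)`, which pays for the thinning of `e` because `(1 - x / 2) * exp
x ≥ 1`. The rest integrates to `exp (-b) * (1 - exp (-b)) / b` (`generating_bound`,
`balanced_bound`).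

For computability, thinning compares `a e` with a uniform integer below `2D`, and the draws use one
uniform rank for each possible number of competitors. After this sampling the program is
deterministic and quadratic in `m`. -/

/-! ### Random sets with independent elements -/

theorem sum_prod_ite_mem {E : Type} [Fintype E] [DecidableEq E] (u v : E → ℝ) :
    ∑ K : Finset E, ∏ f, (if f ∈ K then u f else v f) = ∏ f, (u f + v f) := by
  rw [Finset.prod_add, Finset.powerset_univ]
  refine Finset.sum_congr rfl fun K _ => ?_
  rw [Finset.prod_ite]
  congr 2
  · ext f; simp
  · ext f; simp

theorem sum_roundingProb {E : Type} [Fintype E] [DecidableEq E] (x : E → ℝ) :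
    ∑ K : Finset E, roundingProb x K = 1 := by
  simp [roundingProb, sum_prod_ite_mem]

theorem roundingProb_nonneg {E : Type} [Fintype E] [DecidableEq E] {x : E → ℝ}
    (h0 : ∀ e, 0 ≤ x e) (h1 : ∀ e, x e ≤ 1) (K : Finset E) : 0 ≤ roundingProb x K := by
  refine Finset.prod_nonneg fun f _ => ?_
  split_ifs
  · exact h0 f
  · linarith [h1 f]

/-- The intersection of two independent random sets with independent elements. -/
theorem sum_roundingProb_inter {E : Type} [Fintype E] [DecidableEq E] (x z : E → ℝ)
    (G : Finset E → ℝ) :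
    ∑ A, roundingProb x A * ∑ W, roundingProb z W * G (A ∩ W) =
      ∑ K, roundingProb (fun f => x f * z f) K * G K := by
  have hmass : ∀ K : Finset E,
      ∑ A, ∑ W, roundingProb x A * roundingProb z W * (if A ∩ W = K then 1 else 0) =
        roundingProb (fun f => x f * z f) K := by
    intro K
    -- The event `A ∩ W = K` is a conjunction over elements, so its indicator is a product and both
    -- sums factor coordinatewise.
    have hind : ∀ A W : Finset E, (if A ∩ W = K then (1 : ℝ) else 0) =
        ∏ f, if ((f ∈ A ∧ f ∈ W) ↔ f ∈ K) then (1 : ℝ) else 0 := by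
      intro A W
      rw [Finset.prod_ite_zero]
      simp [Finset.ext_iff]
    have hW : ∀ A : Finset E,
        ∑ W, roundingProb x A * roundingProb z W * (if A ∩ W = K then 1 else 0) =
          ∏ f, if f ∈ A then x f * (if f ∈ K then z f else 1 - z f)
            else (1 - x f) * (if f ∈ K then 0 else 1) := by
      intro A
      calc _ = ∑ W : Finset E, ∏ f, (if f ∈ W then
              (if f ∈ A then x f else 1 - x f) * z f * (if (f ∈ A ↔ f ∈ K) then 1 else 0)
              else (if f ∈ A then x f else 1 - x f) * (1 - z f) *
                (if f ∈ K then 0 else 1)) := by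
            refine Finset.sum_congr rfl fun W _ => ?_
            rw [hind, roundingProb, roundingProb, ← Finset.prod_mul_distrib,
              ← Finset.prod_mul_distrib]
            refine Finset.prod_congr rfl fun f _ => ?_
            by_cases h1 : f ∈ W <;> by_cases h2 : f ∈ K <;> by_cases h3 : f ∈ A <;>
              simp [h1, h2, h3]
        _ = _ := by
            rw [sum_prod_ite_mem]
            refine Finset.prod_congr rfl fun f _ => ?_
            by_cases h2 : f ∈ K <;> by_cases h3 : f ∈ A <;> simp [h2, h3]
            ring
    rw [Finset.sum_congr rfl fun A _ => hW A, sum_prod_ite_mem]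
    refine Finset.prod_congr rfl fun f _ => ?_
    by_cases h2 : f ∈ K
    · simp [h2]
    · simp only [h2, if_false]
      ring
  simp only [← hmass, Finset.sum_mul, Finset.mul_sum]
  rw [Finset.sum_comm' (t' := Finset.univ) (s' := fun _ => Finset.univ) (by simp),
    Finset.sum_comm]
  conv_rhs => rw [Finset.sum_comm]
  refine Finset.sum_congr rfl fun A _ => ?_
  rw [Finset.sum_comm]
  refine Finset.sum_congr rfl fun W _ => ?_
  simp [mul_assoc]

/-! ### Exponential estimates and the balance bound -/

/-- Follows from `exp y ≥ 1 + y + y ^ 2 / 2` and `(1 - y + y ^ 2 / 2) * (1 + y + y ^ 2 / 2) = 1 + y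
^ 4 / 4`. -/
theorem exp_neg_le_quadratic {y : ℝ} (hy : 0 ≤ y) : Real.exp (-y) ≤ 1 - y + y ^ 2 / 2 := by
  have h := Real.quadratic_le_exp_of_nonneg hy
  rw [Real.exp_neg, inv_le_iff_one_le_mul₀ (Real.exp_pos y)]
  nlinarith [sq_nonneg (y ^ 2), sq_nonneg (y - 1)]

/-- The quadratic bound at `x * u` together with `u ^ 2 ≤ u`. This is where the thinning factor `1 -
x / 2` comes from: it makes a single bound serve blockers (`u = 1`) and left competitors (`u = 1 -
t`). -/
theorem exp_neg_mul_le {x u : ℝ} (hx : 0 ≤ x) (hu0 : 0 ≤ u) (hu1 : u ≤ 1) :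
    Real.exp (-(x * u)) ≤ 1 - x * (1 - x / 2) * u := by
  have h := exp_neg_le_quadratic (mul_nonneg hx hu0)
  nlinarith [mul_nonneg (mul_nonneg hx hx) (mul_nonneg hu0 (sub_nonneg.2 hu1))]

theorem one_le_one_sub_half_mul_exp {x : ℝ} (h0 : 0 ≤ x) (h1 : x ≤ 1) :
    1 ≤ (1 - x / 2) * Real.exp x := by
  nlinarith [Real.add_one_le_exp x, mul_nonneg h0 (sub_nonneg.2 h1)]

theorem integral_exp_neg_mul_one_sub {b : ℝ} (hb : 0 < b) :
    ∫ t in (0 : ℝ)..1, Real.exp (-(b * (1 - t))) = (1 - Real.exp (-b)) / b := by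
  have hd : ∀ t ∈ Set.uIcc (0 : ℝ) 1,
      HasDerivAt (fun t => Real.exp (-(b * (1 - t))) / b) (Real.exp (-(b * (1 - t)))) t := by
    intro t _
    have h1 : HasDerivAt (fun t : ℝ => -(b * (1 - t))) b t := by
      have := (((hasDerivAt_id t).const_sub 1).const_mul b).fun_neg
      simpa using this
    have := (h1.exp).div_const b
    rwa [mul_div_assoc, div_self hb.ne', mul_one] at this
  rw [intervalIntegral.integral_eq_sub_of_hasDerivAt hd
    (Continuous.intervalIntegrable (by fun_prop) _ _)]
  simp
  ring

/-- The probability generating function behind `balanced_bound`. -/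
theorem generating_bound {E : Type} [Fintype E] [DecidableEq E] {b : ℝ} (e : E)
    (B L : E → Prop) [DecidablePred B] [DecidablePred L] {x : E → ℝ}
    (h0 : ∀ f, 0 ≤ x f) (h1 : ∀ f, x f ≤ 1)
    (hB : ∑ f with f = e ∨ B f, x f ≤ b) (hL : ∑ f with f ≠ e ∧ L f, x f ≤ b)
    {t : ℝ} (ht0 : 0 ≤ t) (ht1 : t ≤ 1) :
    x e * Real.exp (-b) * Real.exp (-(b * (1 - t))) ≤
      ∑ K : Finset E, roundingProb (fun f => x f * (1 - x f / 2)) K *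
        (if e ∈ K ∧ ∀ f ∈ K, f ≠ e → ¬ B f then t ^ (K.filter fun f => f ≠ e ∧ L f).card
          else 0) := by
  -- Each summand becomes a product of local weights: absence of `e` or presence of a blocker puts a
  -- zero factor in, and each left competitor contributes `t`.
  have hprod : ∀ K : Finset E, roundingProb (fun f => x f * (1 - x f / 2)) K *
        (if e ∈ K ∧ ∀ f ∈ K, f ≠ e → ¬ B f then t ^ (K.filter fun f => f ≠ e ∧ L f).card
          else 0) =
      ∏ f, if f ∈ K then x f * (1 - x f / 2) *
          (if f = e then 1 else if B f then 0 else if L f then t else 1)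
        else (if f = e then 0 else 1 - x f * (1 - x f / 2)) := by
    intro K
    by_cases hK : e ∈ K ∧ ∀ f ∈ K, f ≠ e → ¬ B f
    · have hpow : t ^ (K.filter fun f => f ≠ e ∧ L f).card =
          ∏ f, if f ∈ K ∧ f ≠ e ∧ L f then t else 1 := by
        rw [Finset.prod_ite, Finset.prod_const, Finset.prod_const_one, mul_one]
        congr 2
        ext f; simp
      rw [if_pos hK, hpow, roundingProb, ← Finset.prod_mul_distrib]
      refine Finset.prod_congr rfl fun f _ => ?_
      by_cases hf : f ∈ K
      · by_cases hfe : f = e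
        · subst hfe; simp [hf]
        · simp [hf, hfe, hK.2 f hf hfe]
      · have hfe : f ≠ e := fun h => hf (h ▸ hK.1)
        simp [hf, hfe]
    · rw [if_neg hK, mul_zero, eq_comm]
      by_cases he : e ∈ K
      · have : ∃ f ∈ K, f ≠ e ∧ B f := by
          by_contra hcon
          push Not at hcon
          exact hK ⟨he, hcon⟩
        obtain ⟨f, hf, hfe, hBf⟩ := this
        exact Finset.prod_eq_zero (Finset.mem_univ f) (by simp [hf, hfe, hBf])
      · exact Finset.prod_eq_zero (Finset.mem_univ e) (by simp [he])
  rw [Finset.sum_congr rfl fun K _ => hprod K, sum_prod_ite_mem,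
    ← Finset.mul_prod_erase _ _ (Finset.mem_univ e)]
  have hfac : ∏ f ∈ Finset.univ.erase e, Real.exp (-((if B f then x f else 0) +
        (if L f then x f * (1 - t) else 0))) ≤
      ∏ f ∈ Finset.univ.erase e, (x f * (1 - x f / 2) *
          (if f = e then 1 else if B f then 0 else if L f then t else 1) +
        (if f = e then 0 else 1 - x f * (1 - x f / 2))) := by
    refine Finset.prod_le_prod (fun f _ => (Real.exp_pos _).le) fun f hf => ?_
    have hfe : f ≠ e := Finset.ne_of_mem_erase hf
    rw [if_neg hfe, if_neg hfe]
    by_cases hBf : B f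
    · rw [if_pos hBf, if_pos hBf]
      -- A blocker may also be a left competitor. It is then charged twice on the exponential side,
      -- which only weakens the lower bound.
      have h2 : 0 ≤ (if L f then x f * (1 - t) else 0) := by
        split_ifs
        · exact mul_nonneg (h0 f) (by linarith)
        · exact le_rfl
      have h3 := exp_neg_mul_le (h0 f) zero_le_one le_rfl
      have h4 : Real.exp (-(x f + if L f then x f * (1 - t) else 0)) ≤
        Real.exp (-(x f * 1)) := Real.exp_le_exp.2 (by linarith)
      linarith
    · rw [if_neg hBf, if_neg hBf]
      by_cases hLf : L f
      · rw [if_pos hLf, if_pos hLf, zero_add]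
        have h3 := exp_neg_mul_le (u := 1 - t) (h0 f) (by linarith) (by linarith)
        linarith
      · simp [hLf]
  have hexp : Real.exp (-(b - x e)) * Real.exp (-(b * (1 - t))) ≤
      ∏ f ∈ Finset.univ.erase e, Real.exp (-((if B f then x f else 0) +
        (if L f then x f * (1 - t) else 0))) := by
    rw [← Real.exp_sum, ← Real.exp_add, Real.exp_le_exp, Finset.sum_neg_distrib,
      Finset.sum_add_distrib]
    -- The blocker constraint includes `e` itself, so the other blockers have total mass at most `b
    -- - x e`.
    have e1 : x e + ∑ f ∈ Finset.univ.erase e, (if B f then x f else 0) ≤ b := by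
      refine le_trans (le_of_eq ?_) hB
      rw [Finset.sum_filter, ← Finset.add_sum_erase _ _ (Finset.mem_univ e)]
      simp only [true_or, if_true]
      congr 1
      refine Finset.sum_congr rfl fun f hf => ?_
      simp [Finset.ne_of_mem_erase hf]
    have e2 : ∑ f ∈ Finset.univ.erase e, (if L f then x f * (1 - t) else 0) ≤
        b * (1 - t) := by
      refine le_trans (le_of_eq ?_) (mul_le_mul_of_nonneg_right hL (by linarith))
      rw [Finset.sum_filter, Finset.sum_mul, ← Finset.add_sum_erase _ _ (Finset.mem_univ e)]
      simp only [ne_eq, not_true_eq_false, false_and, if_false, zero_mul, zero_add]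
      refine Finset.sum_congr rfl fun f hf => ?_
      simp [Finset.ne_of_mem_erase hf]
    linarith
  have hx := one_le_one_sub_half_mul_exp (h0 e) (h1 e)
  have hsplit : Real.exp (-(b - x e)) = Real.exp (-b) * Real.exp (x e) := by
    rw [← Real.exp_add]; congr 1; ring
  have hw : 0 ≤ x e * (1 - x e / 2) := mul_nonneg (h0 e) (by linarith [h1 e])
  simp only [if_true, mul_one, add_zero]
  refine le_trans ?_ (mul_le_mul_of_nonneg_left (hexp.trans hfac) hw)
  rw [hsplit]
  have hpos : 0 ≤ x e * Real.exp (-b) * Real.exp (-(b * (1 - t))) := by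
    have := h0 e
    positivity
  -- The saved factor `exp (x e)` compensates for the thinning factor of `e`.
  nlinarith [mul_le_mul_of_nonneg_left hx hpos]

theorem balanced_bound {E : Type} [Fintype E] [DecidableEq E] {b : ℝ} (hb : 0 < b) (e : E)
    (B L : E → Prop) [DecidablePred B] [DecidablePred L] {x : E → ℝ}
    (h0 : ∀ f, 0 ≤ x f) (h1 : ∀ f, x f ≤ 1)
    (hB : ∑ f with f = e ∨ B f, x f ≤ b) (hL : ∑ f with f ≠ e ∧ L f, x f ≤ b) :
    Real.exp (-b) * (1 - Real.exp (-b)) / b * x e ≤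
      ∑ K : Finset E, roundingProb (fun f => x f * (1 - x f / 2)) K *
        (if e ∈ K ∧ ∀ f ∈ K, f ≠ e → ¬ B f then
          1 / (((K.filter fun f => f ≠ e ∧ L f).card : ℝ) + 1) else 0) := by
  -- Integrating in `t` replaces `t ^ k` by `1 / (k + 1)`, the chance of winning against `k`
  -- competitors.
  have hint := intervalIntegral.integral_mono_on (μ := MeasureTheory.volume) zero_le_one
    (Continuous.intervalIntegrable (by fun_prop) _ _)
    (Continuous.intervalIntegrable
      (continuous_finsetSum _ fun K _ => by split_ifs <;> fun_prop) _ _)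
    (fun t ht => generating_bound e B L h0 h1 hB hL ht.1 ht.2)
  rw [intervalIntegral.integral_const_mul, integral_exp_neg_mul_one_sub hb,
    intervalIntegral.integral_finsetSum] at hint
  · refine le_trans (le_of_eq (by ring)) (hint.trans (le_of_eq ?_))
    refine Finset.sum_congr rfl fun K _ => ?_
    rw [intervalIntegral.integral_const_mul]
    split_ifs <;> simp
  · intro K _
    refine Continuous.intervalIntegrable ?_ _ _
    split_ifs <;> fun_prop

/-! ### Inequalities valid on the scaled polytope -/

section Polytope

variable {E : Type} [DecidableEq E] {feasible : Finset E → Prop} {b : ℝ}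
  {x : E → ℝ}

theorem nonneg_of_mem_scaledBy (hb : 0 ≤ b) (hx : x ∈ scaledBy b (feasiblePolytope feasible))
    (e : E) : 0 ≤ x e := by
  obtain ⟨y, hy, rfl⟩ := hx
  have : feasiblePolytope feasible ⊆ {y : E → ℝ | 0 ≤ y e} := by
    refine convexHull_min ?_ (convex_halfSpace_ge (LinearMap.proj (R := ℝ) e).isLinear 0)
    rintro _ ⟨S, _, rfl⟩
    simp only [Set.mem_ofPred_eq]
    split_ifs <;> norm_num
  exact mul_nonneg hb (this hy)

/-- Clique inequality: a feasible set meets `T` at most once, so the linear functional is at most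
`1` on the generators, hence on their convex hull. -/
theorem sum_le_of_mem_scaledBy (hb : 0 ≤ b)
    (hx : x ∈ scaledBy b (feasiblePolytope feasible)) (T : Finset E)
    (hT : ∀ S, feasible S → ∀ e ∈ S, e ∈ T → ∀ f ∈ S, f ∈ T → e = f) :
    ∑ f ∈ T, x f ≤ b := by
  obtain ⟨y, hy, rfl⟩ := hx
  have : feasiblePolytope feasible ⊆ {y : E → ℝ | ∑ f ∈ T, y f ≤ 1} := by
    have hlin : IsLinearMap ℝ fun y : E → ℝ => ∑ f ∈ T, y f :=
      ⟨fun u v => by simp [Finset.sum_add_distrib], fun c u => by simp [Finset.mul_sum]⟩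
    refine convexHull_min ?_ (convex_halfSpace_le hlin 1)
    rintro _ ⟨S, hS, rfl⟩
    simp only [Set.mem_ofPred_eq, Finset.sum_ite_mem, Finset.sum_const, nsmul_eq_mul, mul_one]
    have : (T ∩ S).card ≤ 1 := by
      rw [Finset.card_le_one]
      intro e he f hf
      rw [Finset.mem_inter] at he hf
      exact hT S hS e he.2 he.1 f hf.2 hf.1
    exact_mod_cast this
  have h := mul_le_mul_of_nonneg_left (this hy) hb
  simpa [Finset.mul_sum] using h

theorem le_of_mem_scaledBy (hb : 0 ≤ b) (hx : x ∈ scaledBy b (feasiblePolytope feasible))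
    (e : E) : x e ≤ b := by
  have := sum_le_of_mem_scaledBy hb hx {e} (by simp +contextual)
  simpa using this

end Polytope

/-! ### Laws of independent samples -/

/-- The law of a random set that contains each `e` independently with probability `z e`. -/
noncomputable def roundingPMF {E : Type} [Fintype E] [DecidableEq E] (z : E → ℝ)
    (h0 : ∀ e, 0 ≤ z e) (h1 : ∀ e, z e ≤ 1) : PMF (Finset E) :=
  PMF.ofFintype (fun K => ENNReal.ofReal (roundingProb z K)) (by
    rw [← ENNReal.ofReal_sum_of_nonneg fun K _ => roundingProb_nonneg h0 h1 K,
      sum_roundingProb, ENNReal.ofReal_one])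

/-- The law of `g` after replacing its entries `0, …, N - 1` by independent samples from the
laws `μ 0, …, μ (N - 1)`. -/
noncomputable def sampleSeq (μ : ℕ → PMF ℕ) : ℕ → (ℕ → ℕ) → PMF (ℕ → ℕ)
  | 0, g => PMF.pure g
  | N + 1, g => (sampleSeq μ N g).bind fun h => (μ N).map fun r => Function.update h N r

/-- Independence of the samples, stated for boxes. This suffices for the marginals of the ranks and
for the full law of the thinned set. -/
theorem toOuterMeasure_sampleSeq (μ : ℕ → PMF ℕ) (N : ℕ) (g : ℕ → ℕ) (S : ℕ → Set ℕ) :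
    (sampleSeq μ N g).toOuterMeasure {h | ∀ i < N, h i ∈ S i} =
      ∏ i ∈ Finset.range N, (μ i).toOuterMeasure (S i) := by
  classical
  induction N with
  | zero => simp [sampleSeq]
  | succ N ih =>
    rw [sampleSeq, PMF.toOuterMeasure_bind_apply, Finset.prod_range_succ, ← ih,
      PMF.toOuterMeasure_apply, ← ENNReal.tsum_mul_right]
    refine tsum_congr fun h => ?_
    rw [PMF.toOuterMeasure_map_apply]
    by_cases hh : ∀ i < N, h i ∈ S i
    · rw [Set.indicator_of_mem (show h ∈ {h : ℕ → ℕ | ∀ i < N, h i ∈ S i} from hh)]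
      congr 2
      ext r
      simp only [Set.mem_preimage, Set.mem_ofPred_eq, Nat.lt_succ_iff_lt_or_eq]
      constructor
      · intro H
        simpa using H N (Or.inr rfl)
      · rintro hr i (hi | rfl)
        · rw [Function.update_of_ne hi.ne]
          exact hh i hi
        · simpa using hr
    · rw [Set.indicator_of_notMem (show h ∉ {h : ℕ → ℕ | ∀ i < N, h i ∈ S i} from hh), zero_mul]
      convert mul_zero _
      convert MeasureTheory.measure_empty (μ := (μ N).toOuterMeasure)
      ext r
      simp only [Set.mem_preimage, Set.mem_ofPred_eq, Set.mem_empty_iff_false, iff_false]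
      refine fun H => hh fun i hi => ?_
      simpa [Function.update_of_ne hi.ne] using H i (hi.trans (Nat.lt_succ_self N))

theorem toOuterMeasure_uniformBelow {N : ℕ} (hN : 0 < N) (p : ℕ → Prop) [DecidablePred p] :
    (RandomRAM.uniformBelow N).toOuterMeasure {t | p t} =
      (((Finset.range N).filter p).card : ENNReal) / N := by
  classical
  obtain ⟨N, rfl⟩ := Nat.exists_eq_succ_of_ne_zero hN.ne'
  rw [RandomRAM.uniformBelow, PMF.toOuterMeasure_map_apply,
    PMF.toOuterMeasure_uniformOfFintype_apply]
  congr 1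
  · rw [Nat.cast_inj, Finset.card_filter, Finset.sum_range, ← Finset.card_filter,
      ← Fintype.card_subtype]
    exact Fintype.card_congr (Equiv.refl _)
  · simp

theorem toOuterMeasure_sampleSeq_uniformBelow {m k r : ℕ} (hk : k < m) (hr : r ≤ k)
    (g : ℕ → ℕ) :
    (sampleSeq (fun i => RandomRAM.uniformBelow (i + 1)) m g).toOuterMeasure {h | h k = r} =
      1 / ((k : ENNReal) + 1) := by
  have h := toOuterMeasure_sampleSeq (fun i => RandomRAM.uniformBelow (i + 1)) m g
    (fun i => if i = k then {t | t = r} else Set.univ)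
  have hset : {h : ℕ → ℕ | ∀ i < m, h i ∈ (if i = k then {t | t = r} else Set.univ)} =
      {h | h k = r} := by
    ext h
    simp only [Set.mem_ofPred_eq]
    constructor
    · intro H
      simpa using H k hk
    · intro H i _
      split_ifs with hik
      · subst hik; exact H
      · trivial
  rw [hset] at h
  rw [h, Finset.prod_eq_single k]
  · rw [if_pos rfl, toOuterMeasure_uniformBelow (Nat.succ_pos k)]
    have : (Finset.range (k + 1)).filter (fun t => t = r) = {r} := by
      ext t
      simp only [Finset.mem_filter, Finset.mem_range, Finset.mem_singleton]
      omega
    simp [this]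
  · intro i _ hik
    rw [if_neg hik, (PMF.toOuterMeasure_apply_eq_one_iff _ _).2 (Set.subset_univ _)]
  · intro hk'
    exact absurd (Finset.mem_range.2 hk) hk'

/-! ### The selection rule and the scheme -/

namespace BlockHypergraph

variable {n r m : ℕ}

/-- The hyperedge `f` contains the first right vertex of `e`. -/
def CoversStart (H : BlockHypergraph n r m) (e f : Fin m) : Prop :=
  0 < H.blockLength e ∧ H.blockStart f ≤ H.blockStart e ∧
    H.blockStart e < H.blockStart f + H.blockLength f

/-- The hyperedges of `K` before `e` with the same left code. -/
def leftBefore (H : BlockHypergraph n r m) (K : Finset (Fin m)) (e : Fin m) : Finset (Fin m) :=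
  K.filter fun f => H.leftCode f = H.leftCode e ∧ f < e

/-- The hyperedges of `K` after `e` with the same left code. -/
def leftAfter (H : BlockHypergraph n r m) (K : Finset (Fin m)) (e : Fin m) : Finset (Fin m) :=
  K.filter fun f => H.leftCode f = H.leftCode e ∧ e < f

/-- No other hyperedge of `K` contains the first right vertex of `e`. -/
def Unblocked (H : BlockHypergraph n r m) (K : Finset (Fin m)) (e : Fin m) : Prop :=
  ∀ f ∈ K, f ≠ e → ¬ H.CoversStart e f

open Classical in
/-- The matching selected from `K`: unblocked hyperedges whose rank among the hyperedges of `K`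
with the same left vertex is the one prescribed by `ρ`. -/
noncomputable def select (H : BlockHypergraph n r m) (K : Finset (Fin m)) (ρ : ℕ → ℕ) :
    Finset (Fin m) :=
  K.filter fun e => H.Unblocked K e ∧ (H.leftCode e = 0 ∨
    ρ ((H.leftBefore K e).card + (H.leftAfter K e).card) = (H.leftBefore K e).card)

theorem card_leftBefore_add_card_leftAfter (H : BlockHypergraph n r m) (K : Finset (Fin m))
    (e : Fin m) : (H.leftBefore K e).card + (H.leftAfter K e).card =
      (K.filter fun f => f ≠ e ∧ H.leftCode f = H.leftCode e).card := by
  rw [leftBefore, leftAfter, ← Finset.card_union_of_disjoint]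
  · congr 1
    ext f
    simp only [Finset.mem_union, Finset.mem_filter, ne_eq]
    rw [← not_iff_not.2 (Iff.rfl (a := f = e)), ← ne_eq, ne_iff_lt_or_gt]
    tauto
  · rw [Finset.disjoint_left]
    intro f hf hf'
    rw [Finset.mem_filter] at hf hf'
    exact lt_asymm hf.2.2 hf'.2.2

theorem card_leftBefore_add_card_leftAfter_lt (H : BlockHypergraph n r m)
    (K : Finset (Fin m)) (e : Fin m) :
    (H.leftBefore K e).card + (H.leftAfter K e).card < m := by
  rw [card_leftBefore_add_card_leftAfter]
  refine lt_of_lt_of_eq (Finset.card_lt_univ_of_notMem (x := e) ?_) (Fintype.card_fin m)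
  simp

theorem select_subset (H : BlockHypergraph n r m) (K : Finset (Fin m)) (ρ : ℕ → ℕ) :
    H.select K ρ ⊆ K := fun e he => by
  simp only [select, Finset.mem_filter] at he
  exact he.1

/-- Of two intersecting intervals, the one starting later has its first point in the other. This is
the only use of consecutiveness needed for disjointness on the right. -/
theorem coversStart_of_common (H : BlockHypergraph n r m) {e f : Fin m} {t : Fin r}
    (he : Sum.inr t ∈ H.edge e) (hf : Sum.inr t ∈ H.edge f) :
    H.CoversStart e f ∨ H.CoversStart f e := by
  rw [inr_mem_edge_iff] at he hf
  rcases le_total (H.blockStart e) (H.blockStart f) with h | h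
  · right
    refine ⟨?_, h, ?_⟩ <;> omega
  · left
    refine ⟨?_, h, ?_⟩ <;> omega

/-- Members of one left class have equally many competitors, so they consult the same entry of `ρ`;
their ranks within the class differ, so at most one can match it. -/
theorem select_leftCode_ne (H : BlockHypergraph n r m) {K : Finset (Fin m)} {ρ : ℕ → ℕ}
    {e f : Fin m} (he : e ∈ H.select K ρ) (hf : f ∈ H.select K ρ) (hef : e < f)
    (h0 : H.leftCode e ≠ 0) : H.leftCode f ≠ H.leftCode e := by
  intro hl
  simp only [select, Finset.mem_filter] at he hf
  obtain ⟨heK, -, he⟩ := he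
  obtain ⟨hfK, -, hf⟩ := hf
  have he := he.resolve_left h0
  have hf := hf.resolve_left (hl ▸ h0)
  have hcount : (H.leftBefore K e).card + (H.leftAfter K e).card =
      (H.leftBefore K f).card + (H.leftAfter K f).card := by
    rw [card_leftBefore_add_card_leftAfter, card_leftBefore_add_card_leftAfter]
    have key : ∀ g ∈ K, H.leftCode g = H.leftCode e →
        (K.filter fun f => f ≠ g ∧ H.leftCode f = H.leftCode g).card =
          (K.filter fun f => H.leftCode f = H.leftCode e).card - 1 := by
      intro g hg hge
      rw [← Finset.card_erase_of_mem (Finset.mem_filter.2 ⟨hg, hge⟩)]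
      congr 1
      ext f
      simp only [Finset.mem_filter, Finset.mem_erase, hge]
      tauto
    rw [key e heK rfl, key f hfK hl]
  have hlt : (H.leftBefore K e).card < (H.leftBefore K f).card := by
    refine Finset.card_lt_card ((Finset.ssubset_iff_of_subset ?_).2 ⟨e, ?_, ?_⟩)
    · intro g hg
      simp only [leftBefore, Finset.mem_filter] at hg ⊢
      exact ⟨hg.1, hg.2.1.trans hl.symm, hg.2.2.trans hef⟩
    · simp [leftBefore, heK, hl, hef]
    · simp [leftBefore]
  rw [← hcount] at hf
  omega

theorem isMatching_select (H : BlockHypergraph n r m) (K : Finset (Fin m)) (ρ : ℕ → ℕ) :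
    H.IsMatching (H.select K ρ) := by
  intro e he f hf hef
  rw [Finset.disjoint_left]
  rintro (i | t) hie hif
  · rw [inl_mem_edge_iff] at hie hif
    rcases lt_or_gt_of_ne hef with h | h
    · exact H.select_leftCode_ne he hf h (by omega) (by omega)
    · exact H.select_leftCode_ne hf he h (by omega) (by omega)
  · simp only [select, Finset.mem_filter] at he hf
    rcases H.coversStart_of_common hie hif with h | h
    · exact he.2.1 f hf.1 hef.symm h
    · exact hf.2.1 e he.1 hef h

open Classical in
/-- The probability that `e` is selected from `K`. -/
noncomputable def selectProb (H : BlockHypergraph n r m) (K : Finset (Fin m)) (e : Fin m) : ℝ :=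
  if e ∈ K ∧ ∀ f ∈ K, f ≠ e → ¬ H.CoversStart e f then
    1 / (((K.filter fun f => f ≠ e ∧ H.leftCode e ≠ 0 ∧
      H.leftCode f = H.leftCode e).card : ℝ) + 1) else 0

theorem selectProb_nonneg (H : BlockHypergraph n r m) (K : Finset (Fin m)) (e : Fin m) :
    0 ≤ H.selectProb K e := by
  unfold selectProb
  split_ifs <;> positivity

/-- Enlarging the set adds only blockers and competitors. -/
theorem selectProb_anti (H : BlockHypergraph n r m) {K K' : Finset (Fin m)} {e : Fin m}
    (hK : K ⊆ K') (he : e ∈ K' → e ∈ K) : H.selectProb K' e ≤ H.selectProb K e := by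
  by_cases h : e ∈ K' ∧ ∀ f ∈ K', f ≠ e → ¬ H.CoversStart e f
  · rw [selectProb, selectProb, if_pos h, if_pos ⟨he h.1, fun f hf => h.2 f (hK hf)⟩]
    refine one_div_le_one_div_of_le (by positivity) ?_
    gcongr
  · rw [selectProb, if_neg h]
    exact H.selectProb_nonneg K e

/-- The law of the prescribed ranks. -/
noncomputable def rankLaw (m : ℕ) : PMF (ℕ → ℕ) :=
  sampleSeq (fun i => RandomRAM.uniformBelow (i + 1)) m 0

/-- With `k` competitors, `ρ k` is uniform on `k + 1` values and one of them is the rank of `e`.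
Different left vertices may share an entry of `ρ`; the resulting correlation is harmless since only
marginals matter. -/
theorem toOuterMeasure_select (H : BlockHypergraph n r m) (K : Finset (Fin m)) (e : Fin m) :
    ((rankLaw m).map (H.select K)).toOuterMeasure {S | e ∈ S} =
      ENNReal.ofReal (H.selectProb K e) := by
  rw [PMF.toOuterMeasure_map_apply]
  by_cases h : e ∈ K ∧ ∀ f ∈ K, f ≠ e → ¬ H.CoversStart e f
  · rw [selectProb, if_pos h]
    by_cases h0 : H.leftCode e = 0
    · have : H.select K ⁻¹' {S | e ∈ S} = Set.univ := by
        ext ρ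
        simp only [Set.mem_preimage, Set.mem_ofPred_eq, Set.mem_univ, iff_true, select,
          Finset.mem_filter]
        exact ⟨h.1, h.2, Or.inl h0⟩
      rw [this, (PMF.toOuterMeasure_apply_eq_one_iff _ _).2 (Set.subset_univ _)]
      simp [h0]
    · have : H.select K ⁻¹' {S | e ∈ S} =
          {ρ | ρ ((H.leftBefore K e).card + (H.leftAfter K e).card) =
            (H.leftBefore K e).card} := by
        ext ρ
        simp only [Set.mem_preimage, Set.mem_ofPred_eq, select, Finset.mem_filter]
        exact ⟨fun hρ => hρ.2.2.resolve_left h0, fun hρ => ⟨h.1, h.2, Or.inr hρ⟩⟩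
      rw [this, rankLaw, toOuterMeasure_sampleSeq_uniformBelow
        (H.card_leftBefore_add_card_leftAfter_lt K e) (Nat.le_add_right _ _),
        card_leftBefore_add_card_leftAfter, ENNReal.ofReal_div_of_pos (by positivity),
        ENNReal.ofReal_add (by positivity) zero_le_one]
      simp [h0]
  · rw [selectProb, if_neg h, ENNReal.ofReal_zero]
    convert MeasureTheory.measure_empty (μ := (rankLaw m).toOuterMeasure)
    ext ρ
    simp only [Set.mem_preimage, Set.mem_ofPred_eq, Set.mem_empty_iff_false, iff_false, select,
      Finset.mem_filter]
    exact fun hρ => h ⟨hρ.1, hρ.2.1⟩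

/-- The probability `1 - x / 2` of keeping a hyperedge, truncated to the unit interval. -/
noncomputable def keepProb (x : Fin m → ℝ) (f : Fin m) : ℝ := max 0 (min 1 (1 - x f / 2))

theorem keepProb_nonneg (x : Fin m → ℝ) (f : Fin m) : 0 ≤ keepProb x f := le_max_left _ _

theorem keepProb_le_one (x : Fin m → ℝ) (f : Fin m) : keepProb x f ≤ 1 :=
  max_le zero_le_one (min_le_left _ _)

theorem keepProb_eq {x : Fin m → ℝ} {f : Fin m} (h0 : 0 ≤ x f) (h1 : x f ≤ 1) :
    keepProb x f = 1 - x f / 2 := by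
  rw [keepProb, min_eq_right (by linarith), max_eq_right (by linarith)]

/-- The contention resolution scheme: keep each hyperedge of `A` with probability `1 - x / 2`
and select a matching from the remaining ones. -/
noncomputable def scheme (H : BlockHypergraph n r m) (x : Fin m → ℝ) (A : Finset (Fin m)) :
    PMF (Finset (Fin m)) :=
  (roundingPMF (keepProb x) (keepProb_nonneg x) (keepProb_le_one x)).bind fun W =>
    (rankLaw m).map (H.select (A ∩ W))

theorem probMem_scheme (H : BlockHypergraph n r m) (x : Fin m → ℝ) (A : Finset (Fin m))
    (e : Fin m) : probMem (H.scheme x A) e =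
      ∑ W, roundingProb (keepProb x) W * H.selectProb (A ∩ W) e := by
  have hr := fun W => roundingProb_nonneg (keepProb_nonneg x) (keepProb_le_one x) W
  rw [probMem, scheme, PMF.toOuterMeasure_bind_apply, tsum_fintype]
  simp only [toOuterMeasure_select, roundingPMF, PMF.ofFintype_apply]
  rw [ENNReal.toReal_sum fun W _ => ENNReal.mul_ne_top ENNReal.ofReal_ne_top
    ENNReal.ofReal_ne_top]
  refine Finset.sum_congr rfl fun W _ => ?_
  rw [ENNReal.toReal_mul, ENNReal.toReal_ofReal (hr W),
    ENNReal.toReal_ofReal (H.selectProb_nonneg _ _)]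

theorem isMonotoneBalancedCRS_scheme {b : ℝ} (hb0 : 0 < b) (hb1 : b ≤ 1)
    (H : BlockHypergraph n r m) : IsMonotoneBalancedCRS H.IsMatching b
      (Real.exp (-b) * (1 - Real.exp (-b)) / b) H.scheme where
  feasible_subset x _ A S hS := by
    simp only [scheme, PMF.mem_support_bind_iff, PMF.mem_support_map_iff] at hS
    obtain ⟨W, -, ρ, -, rfl⟩ := hS
    exact ⟨(H.select_subset _ _).trans Finset.inter_subset_left, H.isMatching_select _ _⟩
  monotone x _ A B hAB e he := by
    rw [probMem_scheme, probMem_scheme]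
    refine Finset.sum_le_sum fun W _ => mul_le_mul_of_nonneg_left ?_
      (roundingProb_nonneg (keepProb_nonneg x) (keepProb_le_one x) W)
    refine H.selectProb_anti (Finset.inter_subset_inter_right hAB) fun h => ?_
    exact Finset.mem_inter.2 ⟨he, (Finset.mem_inter.1 h).2⟩
  balanced x hx e := by
    classical
    have h0 := nonneg_of_mem_scaledBy hb0.le hx
    have h1 := fun f => (le_of_mem_scaledBy hb0.le hx f).trans hb1
    simp only [probMem_scheme]
    -- Rounding followed by thinning is a single independent rounding with the product
    -- probabilities.
    rw [sum_roundingProb_inter x (keepProb x) fun K => H.selectProb K e]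
    simp only [fun f => keepProb_eq (h0 f) (h1 f), selectProb]
    convert balanced_bound hb0 e (H.CoversStart e)
      (fun f => H.leftCode e ≠ 0 ∧ H.leftCode f = H.leftCode e) h0 h1 ?_ ?_
    · refine sum_le_of_mem_scaledBy hb0.le hx _ fun S hS f hf hfT g hg hgT => ?_
      by_contra hfg
      simp only [Finset.mem_filter, Finset.mem_univ, true_and] at hfT hgT
      -- If `e` has right vertices, `e` and its blockers all contain its first one, so a matching
      -- has at most one of them. Otherwise nothing blocks `e` and the sum is over `{e}`.
      by_cases hlen : 0 < H.blockLength e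
      · have hee : H.CoversStart e e := ⟨hlen, le_rfl, by omega⟩
        have hf' : H.CoversStart e f := hfT.elim (fun h => h ▸ hee) id
        have hg' : H.CoversStart e g := hgT.elim (fun h => h ▸ hee) id
        obtain ⟨t, ht⟩ : ∃ t, Sum.inr t ∈ H.edge e := by
          obtain ⟨t, ht⟩ := Finset.card_pos.1 hlen
          exact ⟨t, (Finset.mem_filter.1 ht).2⟩
        have hs := (H.inr_mem_edge_iff e t).1 ht
        have hmem : ∀ f, H.CoversStart e f →
            Sum.inr ⟨H.blockStart e, hs.1.trans_lt t.2⟩ ∈ H.edge f := fun f hf =>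
          (H.inr_mem_edge_iff f _).2 hf.2
        exact Finset.disjoint_left.1 (hS f hf g hg hfg) (hmem f hf') (hmem g hg')
      · exact hfg ((hfT.resolve_right fun h => hlen h.1).trans
          (hgT.resolve_right fun h => hlen h.1).symm)
    · refine sum_le_of_mem_scaledBy hb0.le hx _ fun S hS f hf hfT g hg hgT => ?_
      by_contra hfg
      simp only [Finset.mem_filter, Finset.mem_univ, true_and] at hfT hgT
      -- A nonzero left code comes from an actual left vertex, shared by all competitors.
      obtain ⟨i, hi⟩ : ∃ i, Sum.inl i ∈ H.edge e := by
        by_contra hcon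
        push Not at hcon
        exact hfT.2.1 (Finset.sum_eq_zero fun i _ => if_neg (hcon i))
      have hmem : ∀ f, H.leftCode f = H.leftCode e → Sum.inl i ∈ H.edge f := fun f hf =>
        (H.inl_mem_edge_iff f i).2 (hf.trans ((H.inl_mem_edge_iff e i).1 hi))
      exact Finset.disjoint_left.1 (hS f hf g hg hfg) (hmem f hfT.2.2) (hmem g hgT.2.2)

end BlockHypergraph

/-! ### Program logic and the subprograms -/

namespace RandomRAM

/-- From `s` the program deterministically reaches a state with property `Q` within `t` steps. -/
def Reaches (c : Program) (s : State) (t : ℕ) (Q : State → Prop) : Prop :=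
  ∃ s' k, c.run s = PMF.pure (s', k) ∧ k ≤ t ∧ Q s'

namespace Reaches

variable {c d : Program} {s : State} {t t' N : ℕ} {Q R : State → Prop}

theorem imp (h : Reaches c s t Q) (hQ : ∀ s', Q s' → R s') : Reaches c s t R := by
  obtain ⟨s', k, h1, h2, h3⟩ := h
  exact ⟨s', k, h1, h2, hQ s' h3⟩

theorem skip (h : Q s) : Reaches .skip s (t + 1) Q :=
  ⟨s, 1, rfl, Nat.le_add_left _ _, h⟩

theorem set {v : ℕ} {p : Expr} (h : Q (s.setReg v (p.eval s))) :
    Reaches (.set v p) s (t + 1) Q :=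
  ⟨_, 1, rfl, Nat.le_add_left _ _, h⟩

theorem put {k : ℕ} {i p : Expr} (h : Q (s.setArr k (i.eval s) (p.eval s))) :
    Reaches (.put k i p) s (t + 1) Q :=
  ⟨_, 1, rfl, Nat.le_add_left _ _, h⟩

theorem seq (h : Reaches c s t fun s' => Reaches d s' t' Q) :
    Reaches (.seq c d) s (t + t') Q := by
  obtain ⟨s', k, h1, h2, s'', k', h1', h2', h3⟩ := h
  refine ⟨s'', k + k', ?_, add_le_add h2 h2', h3⟩
  rw [Program.run, h1, PMF.pure_bind]
  simp only [h1', PMF.pure_map]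

theorem ifLt {p q : Expr} (h : p.eval s < q.eval s → Reaches c s t Q)
    (h' : q.eval s ≤ p.eval s → Reaches d s t Q) : Reaches (.ifLt p q c d) s (t + 1) Q := by
  by_cases hpq : p.eval s < q.eval s
  · obtain ⟨s', k, h1, h2, h3⟩ := h hpq
    exact ⟨s', k + 1, by rw [Program.run, if_pos hpq, h1, PMF.pure_map], by omega, h3⟩
  · obtain ⟨s', k, h1, h2, h3⟩ := h' (not_lt.1 hpq)
    exact ⟨s', k + 1, by rw [Program.run, if_neg hpq, h1, PMF.pure_map], by omega, h3⟩

/-- The counter is reassigned before every round, so the invariant need not mention it and the body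
may overwrite it. -/
theorem loop {v : ℕ} {p : Expr} (I : ℕ → State → Prop) (hN : p.eval s = N) (h0 : I 0 s)
    (hstep : ∀ k < N, ∀ s', I k s' → Reaches c (s'.setReg v k) t (I (k + 1))) :
    Reaches (.loop v p c) s (N * (t + 1) + 1) (I N) := by
  have key : ∀ k ≤ N, ∃ s' j, loopRun v c.run k s = PMF.pure (s', j) ∧
      j ≤ k * (t + 1) + 1 ∧ I k s' := by
    intro k
    induction k with
    | zero => exact fun _ => ⟨s, 1, rfl, by omega, h0⟩
    | succ k ih =>
      intro hk
      obtain ⟨s', j, h1, h2, h3⟩ := ih (by omega)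
      obtain ⟨s'', j', h1', h2', h3'⟩ := hstep k hk s' h3
      refine ⟨s'', j + j' + 1, ?_, ?_, h3'⟩
      · rw [loopRun, h1, PMF.pure_bind]
        simp only [h1', PMF.pure_map]
      · rw [Nat.succ_mul]
        omega
  obtain ⟨s', j, h1, h2, h3⟩ := key N le_rfl
  exact ⟨s', j, by rw [Program.run, hN, h1], h2, h3⟩

end Reaches

/-- Fills the first `reg 2` entries of array `k` with uniform samples below the value of `p`,
which may refer to the index through register `4`. -/
def sampleProgram (k : ℕ) (p : Expr) : Program :=
  .loop 4 (.reg 2) (.seq (.rand 5 p) (.seq (.put k (.reg 4) (.reg 5))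
    (.seq (.set 4 (.const 0)) (.set 5 (.const 0)))))

/-- The state `s` with array `k` replaced by `h`. -/
def State.withArr (s : State) (k : ℕ) (h : ℕ → ℕ) : State :=
  { s with arr := Function.update s.arr k h }

/-- Since the registers `4` and `5` are reset in each round, the final state differs from `s` only
in array `k`. Its law is thus exactly an image of `sampleSeq`, with a constant step count. -/
theorem run_sampleProgram (k : ℕ) (p : Expr) (s : State) (h4 : s.reg 4 = 0)
    (h5 : s.reg 5 = 0) (M : ℕ → ℕ)
    (hp : ∀ h i, p.eval ((s.withArr k h).setReg 4 i) = M i) :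
    (sampleProgram k p).run s =
      (sampleSeq (fun i => uniformBelow (M i)) (s.reg 2) (s.arr k)).map fun h =>
        (s.withArr k h, s.reg 2 * 5 + 1) := by
  have key : ∀ N, loopRun 4 (Program.run (.seq (.rand 5 p) (.seq (.put k (.reg 4) (.reg 5))
      (.seq (.set 4 (.const 0)) (.set 5 (.const 0)))))) N s =
      (sampleSeq (fun i => uniformBelow (M i)) N (s.arr k)).map fun h =>
        (s.withArr k h, N * 5 + 1) := by
    intro N
    induction N with
    | zero => simp [loopRun, sampleSeq, PMF.pure_map, State.withArr]
    | succ N ih =>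
      rw [loopRun, ih, sampleSeq, PMF.bind_map, PMF.map_bind]
      congr 1
      funext h
      simp only [Function.comp_apply, Program.run, hp, PMF.bind_map, PMF.pure_map,
        PMF.map_comp, PMF.pure_bind, PMF.map_bind]
      rw [← PMF.bind_pure_comp]
      congr 1
      funext u
      simp only [Function.comp_apply, Expr.eval, State.setReg, State.setArr,
        State.withArr]
      congr 2
      · congr 1
        · funext v
          by_cases hv4 : v = 4
          · simp [hv4, h4]
          · by_cases hv5 : v = 5
            · simp [hv5, h5]
            · simp [hv4, hv5]
        · simp
      · ring
  exact key _

/-- Clears the entries of array `4` whose entry in array `6` is below the one in array `3`. -/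
def trimProgram : Program :=
  .loop 4 (.reg 2) (.ifLt (.get 6 (.reg 4)) (.get 3 (.reg 4)) (.put 4 (.reg 4) (.const 0)) .skip)

theorem reaches_trimProgram (s : State) :
    Reaches trimProgram s (s.reg 2 * 3 + 1) fun s' =>
      s'.reg 2 = s.reg 2 ∧ s'.arr = Function.update s.arr 4 fun i =>
        if i < s.reg 2 ∧ s.arr 6 i < s.arr 3 i then 0 else s.arr 4 i := by
  refine Reaches.loop (t := 2) (fun k s' => s'.reg 2 = s.reg 2 ∧
    s'.arr = Function.update s.arr 4 fun i =>
      if i < k ∧ s.arr 6 i < s.arr 3 i then 0 else s.arr 4 i) rfl (by simp) ?_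
  rintro k - s' ⟨h2, ha⟩
  refine Reaches.ifLt (fun h => Reaches.put ?_) (fun h => Reaches.skip ?_)
  all_goals
    simp only [Expr.eval, State.setReg, ha, ne_eq, Nat.reduceEqDiff,
      not_false_eq_true, Function.update_of_ne, Function.update_self] at h
    refine ⟨by simpa [State.setReg, State.setArr] using h2, ?_⟩
    simp only [State.setReg, State.setArr, ha, Expr.eval, Function.update_self,
      Function.update_idem]
    congr 1
    funext i
  · by_cases hi : i = k
    · subst hi; simp [h]
    · rw [Function.update_of_ne hi]
      simp only [show i < k + 1 ↔ i < k by omega]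
  · by_cases hi : i = k
    · subst hi; simp [not_lt.2 h]
    · simp only [show i < k + 1 ↔ i < k by omega]

/-- `f` is a kept hyperedge before `e` with the same left code. -/
def IsBefore (u : ℕ → ℕ → ℕ) (e f : ℕ) : Prop := 0 < u 4 f ∧ u 0 f = u 0 e ∧ f < e

/-- `f` is a kept hyperedge after `e` with the same left code. -/
def IsAfter (u : ℕ → ℕ → ℕ) (e f : ℕ) : Prop := 0 < u 4 f ∧ u 0 f = u 0 e ∧ e < f

/-- `f` is a kept hyperedge other than `e` that contains the first right vertex of `e`. -/
def IsBlocker (u : ℕ → ℕ → ℕ) (e f : ℕ) : Prop :=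
  0 < u 4 f ∧ f ≠ e ∧ 0 < u 2 e ∧ u 1 f ≤ u 1 e ∧ u 1 e < u 1 f + u 2 f

instance (u : ℕ → ℕ → ℕ) (e : ℕ) : DecidablePred (IsBefore u e) := fun _ =>
  inferInstanceAs (Decidable (_ ∧ _))

instance (u : ℕ → ℕ → ℕ) (e : ℕ) : DecidablePred (IsAfter u e) := fun _ =>
  inferInstanceAs (Decidable (_ ∧ _))

instance (u : ℕ → ℕ → ℕ) (e : ℕ) : DecidablePred (IsBlocker u e) := fun _ =>
  inferInstanceAs (Decidable (_ ∧ _))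

/-- The number of `f < N` with property `p`. -/
def countBelow (p : ℕ → Prop) [DecidablePred p] (N : ℕ) : ℕ :=
  ∑ f ∈ Finset.range N, if p f then 1 else 0

theorem countBelow_zero (p : ℕ → Prop) [DecidablePred p] : countBelow p 0 = 0 := rfl

theorem countBelow_succ (p : ℕ → Prop) [DecidablePred p] (N : ℕ) :
    countBelow p (N + 1) = countBelow p N + if p N then 1 else 0 :=
  Finset.sum_range_succ _ _

theorem countBelow_congr {p q : ℕ → Prop} [DecidablePred p] [DecidablePred q]
    (h : ∀ f, p f ↔ q f) (N : ℕ) : countBelow p N = countBelow q N := by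
  simp only [countBelow, h]

/-- Adds one to register `v`. -/
def increment (v : ℕ) : Program := .set v (.add (.reg v) (.const 1))

/-- Updates the counters in the registers `7` and `8` for the pair `e = reg 4`, `f = reg 6`. -/
def leftTest : Program :=
  .ifLt (.const 0) (.get 4 (.reg 6))
    (.ifLt (.get 0 (.reg 6)) (.get 0 (.reg 4)) .skip
      (.ifLt (.get 0 (.reg 4)) (.get 0 (.reg 6)) .skip
        (.ifLt (.reg 6) (.reg 4) (increment 7)
          (.ifLt (.reg 4) (.reg 6) (increment 8) .skip)))) .skip

/-- Updates the counter in register `9` for the pair `e = reg 4`, `f = reg 6`. -/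
def blockTest : Program :=
  .ifLt (.const 0) (.get 4 (.reg 6))
    (.ifLt (.const 0) (.get 2 (.reg 4))
      (.ifLt (.get 1 (.reg 4)) (.get 1 (.reg 6)) .skip
        (.ifLt (.get 1 (.reg 4)) (.add (.get 1 (.reg 6)) (.get 2 (.reg 6)))
          (.ifLt (.reg 6) (.reg 4) (increment 9)
            (.ifLt (.reg 4) (.reg 6) (increment 9) .skip)) .skip)) .skip) .skip

theorem reaches_leftTest {s : State} {e f x y z M : ℕ} {u : ℕ → ℕ → ℕ} (h2 : s.reg 2 = M)
    (h4 : s.reg 4 = e) (h6 : s.reg 6 = f) (hu : s.arr = u) (h7 : s.reg 7 = x)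
    (h8 : s.reg 8 = y) (h9 : s.reg 9 = z) :
    Reaches leftTest s 6 fun s' => s'.reg 2 = M ∧ s'.reg 4 = e ∧ s'.reg 6 = f ∧
      s'.arr = u ∧ s'.reg 7 = x + (if IsBefore u e f then 1 else 0) ∧
      s'.reg 8 = y + (if IsAfter u e f then 1 else 0) ∧ s'.reg 9 = z := by
  subst h2 h4 h6 hu h7 h8 h9
  have hb : IsBefore s.arr (s.reg 4) (s.reg 6) ↔ 
      0 < s.arr 4 (s.reg 6) ∧ s.arr 0 (s.reg 6) = s.arr 0 (s.reg 4) ∧ s.reg 6 < s.reg 4 := Iff.rfl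
  have ha : IsAfter s.arr (s.reg 4) (s.reg 6) ↔
      0 < s.arr 4 (s.reg 6) ∧ s.arr 0 (s.reg 6) = s.arr 0 (s.reg 4) ∧ s.reg 4 < s.reg 6 := Iff.rfl
  unfold leftTest increment
  -- Symbolic execution of all branches; at each leaf the guards collected on the way decide the
  -- indicators by linear arithmetic.
  repeat' first
    | refine Reaches.ifLt (fun _ => ?_) (fun _ => ?_)
    | refine Reaches.skip ?_
    | refine Reaches.set ?_
  all_goals
    simp only [Expr.eval] at *
    simp only [State.setReg, Function.update_self, ne_eq,
      Nat.reduceEqDiff, not_false_eq_true, Function.update_of_ne,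
      true_and, and_true, hb, ha]
    try constructor
    all_goals split_ifs <;> omega

theorem reaches_blockTest {s : State} {e f x y z M : ℕ} {u : ℕ → ℕ → ℕ} (h2 : s.reg 2 = M)
    (h4 : s.reg 4 = e) (h6 : s.reg 6 = f) (hu : s.arr = u) (h7 : s.reg 7 = x)
    (h8 : s.reg 8 = y) (h9 : s.reg 9 = z) :
    Reaches blockTest s 7 fun s' => s'.reg 2 = M ∧ s'.reg 4 = e ∧
      s'.arr = u ∧ s'.reg 7 = x ∧ s'.reg 8 = y ∧
      s'.reg 9 = z + (if IsBlocker u e f then 1 else 0) := by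
  subst h2 h4 h6 hu h7 h8 h9
  have hb : IsBlocker s.arr (s.reg 4) (s.reg 6) ↔
      0 < s.arr 4 (s.reg 6) ∧ s.reg 6 ≠ s.reg 4 ∧ 0 < s.arr 2 (s.reg 4) ∧ s.arr 1 (s.reg 6) ≤ s.arr 1 (s.reg 4) ∧
        s.arr 1 (s.reg 4) < s.arr 1 (s.reg 6) + s.arr 2 (s.reg 6) := Iff.rfl
  unfold blockTest increment
  repeat' first
    | refine Reaches.ifLt (fun _ => ?_) (fun _ => ?_)
    | refine Reaches.skip ?_
    | refine Reaches.set ?_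
  all_goals
    simp only [Expr.eval] at *
    simp only [State.setReg, Function.update_self, ne_eq,
      Nat.reduceEqDiff, not_false_eq_true, Function.update_of_ne,
      true_and, hb]
    split_ifs <;> omega

/-- Counts the competitors of `e = reg 4` in the registers `7`, `8`, `9`. -/
def countProgram : Program :=
  .seq (.set 7 (.const 0)) (.seq (.set 8 (.const 0)) (.seq (.set 9 (.const 0))
    (.loop 6 (.reg 2) (.seq leftTest blockTest))))

theorem reaches_countProgram {s : State} {e M : ℕ} {u : ℕ → ℕ → ℕ} (h2 : s.reg 2 = M)
    (h4 : s.reg 4 = e) (hu : s.arr = u) :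
    Reaches countProgram s (1 + (1 + (1 + (M * 14 + 1)))) fun s' => s'.reg 2 = M ∧
      s'.reg 4 = e ∧ s'.arr = u ∧ s'.reg 7 = countBelow (IsBefore u e) M ∧
      s'.reg 8 = countBelow (IsAfter u e) M ∧ s'.reg 9 = countBelow (IsBlocker u e) M := by
  refine Reaches.seq (Reaches.set (t := 0) (Reaches.seq (Reaches.set (t := 0)
    (Reaches.seq (Reaches.set (t := 0) ?_)))))
  refine Reaches.loop (t := 13) (fun k s' => s'.reg 2 = M ∧ s'.reg 4 = e ∧ s'.arr = u ∧
    s'.reg 7 = countBelow (IsBefore u e) k ∧ s'.reg 8 = countBelow (IsAfter u e) k ∧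
    s'.reg 9 = countBelow (IsBlocker u e) k) ?_ ?_ ?_
  · simpa [Expr.eval, State.setReg] using h2
  · simp [Expr.eval, State.setReg, countBelow_zero, h2, h4, hu]
  · rintro k - s' ⟨i2, i4, iu, i7, i8, i9⟩
    refine Reaches.seq (t := 6) (t' := 7) ((reaches_leftTest (s := s'.setReg 6 k) (M := M)
      (e := e) (f := k) (u := u) ?_ ?_ ?_ ?_ rfl rfl rfl).imp ?_)
    · simpa [State.setReg] using i2
    · simpa [State.setReg] using i4
    · simp [State.setReg]
    · simpa [State.setReg] using iu
    rintro s'' ⟨j2, j4, j6, ju, j7, j8, j9⟩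
    refine (reaches_blockTest j2 j4 j6 ju j7 j8 j9).imp ?_
    rintro s₃ ⟨l2, l4, lu, l7, l8, l9⟩
    refine ⟨l2, l4, lu, ?_, ?_, ?_⟩
    · rw [l7, countBelow_succ, ← i7]; simp [State.setReg]
    · rw [l8, countBelow_succ, ← i8]; simp [State.setReg]
    · rw [l9, countBelow_succ, ← i9]; simp [State.setReg]

/-- The hyperedge `e` is selected. -/
def IsSelected (u : ℕ → ℕ → ℕ) (M e : ℕ) : Prop :=
  0 < u 4 e ∧ countBelow (IsBlocker u e) M = 0 ∧ (u 0 e = 0 ∨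
    u 7 (countBelow (IsBefore u e) M + countBelow (IsAfter u e) M) =
      countBelow (IsBefore u e) M)

instance (u : ℕ → ℕ → ℕ) (M : ℕ) : DecidablePred (IsSelected u M) := fun _ =>
  inferInstanceAs (Decidable (_ ∧ _))

/-- Marks the hyperedge `e = reg 4` in array `5` if it is selected. -/
def markProgram : Program :=
  .ifLt (.const 0) (.get 4 (.reg 4))
    (.ifLt (.const 0) (.reg 9) .skip
      (.ifLt (.const 0) (.get 0 (.reg 4))
        (.ifLt (.get 7 (.add (.reg 7) (.reg 8))) (.reg 7) .skip
          (.ifLt (.reg 7) (.get 7 (.add (.reg 7) (.reg 8))) .skip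
            (.put 5 (.reg 4) (.const 1))))
        (.put 5 (.reg 4) (.const 1)))) .skip

theorem reaches_markProgram {s : State} {e M : ℕ} {u : ℕ → ℕ → ℕ} (h2 : s.reg 2 = M)
    (h4 : s.reg 4 = e) (hu : s.arr = u) (h7 : s.reg 7 = countBelow (IsBefore u e) M)
    (h8 : s.reg 8 = countBelow (IsAfter u e) M)
    (h9 : s.reg 9 = countBelow (IsBlocker u e) M) :
    Reaches markProgram s 6 fun s' => s'.reg 2 = M ∧ s'.arr =
      if IsSelected u M e then Function.update u 5 (Function.update (u 5) e 1) else u := by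
  subst h4 hu
  have hs : IsSelected s.arr M (s.reg 4) ↔ 0 < s.arr 4 (s.reg 4) ∧
    countBelow (IsBlocker s.arr (s.reg 4)) M = 0 ∧ (s.arr 0 (s.reg 4) = 0 ∨
    s.arr 7 (countBelow (IsBefore s.arr (s.reg 4)) M +
      countBelow (IsAfter s.arr (s.reg 4)) M) =
      countBelow (IsBefore s.arr (s.reg 4)) M) := Iff.rfl
  unfold markProgram
  repeat' first
    | refine Reaches.ifLt (fun _ => ?_) (fun _ => ?_)
    | refine Reaches.skip ?_
    | refine Reaches.put ?_
  all_goals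
    simp only [Expr.eval, h7, h8, h9] at *
    refine ⟨h2, ?_⟩
    first
      | rw [if_pos (hs.2 (by omega))]; rfl
      | rw [if_neg (fun h => absurd (hs.1 h) (by omega))]

/-- Marks the selected hyperedges in array `5`. -/
def selectProgram : Program := .loop 4 (.reg 2) (.seq countProgram markProgram)

/-- Marks are written to array `5` only, so earlier rounds do not influence later decisions. -/
theorem isSelected_congr {u u' : ℕ → ℕ → ℕ} {M e : ℕ} (h : ∀ k, k ≠ 5 → u k = u' k) :
    IsSelected u M e ↔ IsSelected u' M e := by
  have h0 := h 0 (by decide)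
  have h4 := h 4 (by decide)
  have hblock : ∀ f, IsBlocker u e f ↔ IsBlocker u' e f := fun f => by
    rw [IsBlocker, IsBlocker, h4, h 1 (by decide), h 2 (by decide)]
  have hbefore : ∀ f, IsBefore u e f ↔ IsBefore u' e f := fun f => by
    rw [IsBefore, IsBefore, h4, h0]
  have hafter : ∀ f, IsAfter u e f ↔ IsAfter u' e f := fun f => by
    rw [IsAfter, IsAfter, h4, h0]
  rw [IsSelected, IsSelected, countBelow_congr hblock, countBelow_congr hbefore,
    countBelow_congr hafter, h0, h4, h 7 (by decide)]

theorem reaches_selectProgram (s : State) (h5 : s.arr 5 = 0) :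
    Reaches selectProgram s (s.reg 2 * (s.reg 2 * 14 + 11) + 1) fun s' => s'.arr 5 = fun i =>
      if i < s.reg 2 ∧ IsSelected s.arr (s.reg 2) i then 1 else 0 := by
  have h := Reaches.loop (c := .seq countProgram markProgram) (s := s) (v := 4)
    (p := .reg 2) (N := s.reg 2) (t := s.reg 2 * 14 + 10)
    (fun k s' => s'.reg 2 = s.reg 2 ∧ s'.arr = Function.update s.arr 5 fun i =>
      if i < k ∧ IsSelected s.arr (s.reg 2) i then 1 else 0) rfl ?_ ?_
  · refine Reaches.imp h ?_
    rintro s' ⟨-, h⟩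
    rw [h, Function.update_self]
  · refine ⟨rfl, ?_⟩
    rw [eq_comm, Function.update_eq_self_iff, h5]
    funext i
    simp
  · rintro k - s' ⟨h2, ha⟩
    have ht : s.reg 2 * 14 + 10 = 1 + (1 + (1 + (s.reg 2 * 14 + 1))) + 6 := by ring
    rw [ht]
    refine Reaches.seq ((reaches_countProgram (s := s'.setReg 4 k) (M := s.reg 2) (e := k)
      (u := s'.arr) (by simpa [State.setReg] using h2) (by simp [State.setReg]) rfl).imp ?_)
    rintro s'' ⟨j2, j4, ju, j7, j8, j9⟩
    refine (reaches_markProgram j2 j4 ju j7 j8 j9).imp ?_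
    rintro s₃ ⟨l2, la⟩
    refine ⟨l2, ?_⟩
    have hsel : IsSelected s'.arr (s.reg 2) k ↔ IsSelected s.arr (s.reg 2) k :=
      isSelected_congr fun j hj => by rw [ha, Function.update_of_ne hj]
    rw [la]
    split_ifs with hk
    · rw [ha, Function.update_self, Function.update_idem]
      congr 1
      funext i
      by_cases hi : i = k
      · subst hi; simp [hsel.1 hk]
      · rw [Function.update_of_ne hi]
        simp only [show i < k + 1 ↔ i < k by omega]
    · rw [ha]
      congr 1
      funext i
      by_cases hi : i = k
      · subst hi; simp [mt hsel.2 hk]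
      · simp only [show i < k + 1 ↔ i < k by omega]

end RandomRAM

/-! ### The program samples the scheme -/

namespace RandomRAM

variable {n r m : ℕ}

theorem countBelow_eq_card (p : ℕ → Prop) [DecidablePred p] (K : Finset (Fin m))
    (h : ∀ f : Fin m, f ∈ K ↔ p f) : countBelow p m = K.card := by
  rw [countBelow, Finset.sum_range, ← Finset.card_filter]
  congr 1
  ext f
  simp [h]

theorem toArray_coe (g : Fin m → ℕ) (f : Fin m) : toArray g f = g f := by
  simp [toArray]

theorem isSelected_iff (H : BlockHypergraph n r m) (K : Finset (Fin m)) (ρ : ℕ → ℕ)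
    (u : ℕ → ℕ → ℕ) (h0 : u 0 = toArray H.leftCode) (h1 : u 1 = toArray H.blockStart)
    (h2 : u 2 = toArray H.blockLength) (h4 : ∀ f : Fin m, 0 < u 4 f ↔ f ∈ K)
    (h7 : u 7 = ρ) (e : Fin m) : IsSelected u m e ↔ e ∈ H.select K ρ := by
  have hbefore : countBelow (IsBefore u e) m = (H.leftBefore K e).card :=
    countBelow_eq_card _ _ fun f => by
      rw [IsBefore, BlockHypergraph.leftBefore, Finset.mem_filter, h4, h0, toArray_coe,
        toArray_coe, Fin.lt_def]
  have hafter : countBelow (IsAfter u e) m = (H.leftAfter K e).card :=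
    countBelow_eq_card _ _ fun f => by
      rw [IsAfter, BlockHypergraph.leftAfter, Finset.mem_filter, h4, h0, toArray_coe,
        toArray_coe, Fin.lt_def]
  have hblock : countBelow (IsBlocker u e) m = 0 ↔ H.Unblocked K e := by
    classical
    rw [countBelow_eq_card (m := m) _ (K.filter fun f => f ≠ e ∧ H.CoversStart e f) fun f => by
      rw [IsBlocker, Finset.mem_filter, h4, h1, h2, BlockHypergraph.CoversStart, ne_eq, ne_eq,
        Fin.ext_iff]
      simp only [toArray_coe], Finset.card_eq_zero, Finset.filter_eq_empty_iff]
    simp only [BlockHypergraph.Unblocked, not_and]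
  simp only [IsSelected, BlockHypergraph.select, Finset.mem_filter, h4, hblock, hbefore, hafter,
    h0, h7, toArray_coe]

theorem reaches_trim_select (H : BlockHypergraph n r m) (D : ℕ) (a : Fin m → ℕ)
    (A : Finset (Fin m)) (κ ρ : ℕ → ℕ) :
    Reaches (.seq trimProgram selectProgram)
      (((initialState H D a A).withArr 6 κ).withArr 7 ρ)
      ((m * 3 + 1) + (m * (m * 14 + 11) + 1)) fun s' =>
        output m s' = H.select (A ∩ Finset.univ.filter fun f : Fin m => a f ≤ κ f) ρ := by
  set s := ((initialState H D a A).withArr 6 κ).withArr 7 ρ with hs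
  have hreg : s.reg 2 = m := rfl
  refine Reaches.seq ((reaches_trimProgram s).imp ?_)
  rintro s' ⟨h2, ha⟩
  rw [hreg] at h2
  have h := reaches_selectProgram s' (by rw [ha]; rfl)
  rw [h2] at h
  refine h.imp fun s'' h5 => ?_
  ext e
  rw [output, Finset.mem_filter, h5, ← isSelected_iff H _ ρ s'.arr (by rw [ha]; rfl)
    (by rw [ha]; rfl) (by rw [ha]; rfl) _ (by rw [ha]; rfl)]
  · simp
  · intro f
    have e6 : s.arr 6 f = κ f := rfl
    have e3 : s.arr 3 f = a f := toArray_coe a f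
    have e4 : s.arr 4 f = if f ∈ A then 1 else 0 := toArray_coe (fun f => if f ∈ A then 1 else 0) f
    rw [ha, Function.update_self, hreg, e6, e3, e4]
    by_cases h1 : κ f < a f
    · simp [h1]
    · by_cases h3 : f ∈ A <;> simp [h1, h3, not_lt.1 h1]

/-- A uniform integer below `2D` is at least `a f` with probability `(2D - a f) / (2D) = 1 - x f /
2`, so thinning is exact in integer arithmetic. -/
theorem sampleSeq_map_eq_roundingPMF {D : ℕ} (hD : 0 < D) (a : Fin m → ℕ) (ha : ∀ f, a f ≤ D)
    (g : ℕ → ℕ) :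
    (sampleSeq (fun _ => uniformBelow (D + D)) m g).map
        (fun κ => Finset.univ.filter fun f : Fin m => a f ≤ κ f) =
      roundingPMF (BlockHypergraph.keepProb fun f => (a f : ℝ) / D)
        (BlockHypergraph.keepProb_nonneg _) (BlockHypergraph.keepProb_le_one _) := by
  ext K
  have hDr : (0 : ℝ) < D := Nat.cast_pos.2 hD
  rw [← PMF.toOuterMeasure_apply_singleton, PMF.toOuterMeasure_map_apply]
  have hset : (fun κ : ℕ → ℕ => Finset.univ.filter fun f : Fin m => a f ≤ κ f) ⁻¹' {K} =
      {κ | ∀ i < m, κ i ∈ {t | ∀ h : i < m, a ⟨i, h⟩ ≤ t ↔ ⟨i, h⟩ ∈ K}} := by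
    ext κ
    simp only [Set.mem_preimage, Set.mem_singleton_iff, Set.mem_ofPred_eq, Finset.ext_iff,
      Finset.mem_filter, Finset.mem_univ, true_and]
    exact ⟨fun h i hi _ => h ⟨i, hi⟩, fun h f => h f f.2 f.2⟩
  have hx0 : ∀ f, 0 ≤ (a f : ℝ) / D := fun f => by positivity
  have hx1 : ∀ f, (a f : ℝ) / D ≤ 1 := fun f => (div_le_one hDr).2 (by exact_mod_cast ha f)
  rw [hset, toOuterMeasure_sampleSeq, Finset.prod_range, roundingPMF, PMF.ofFintype_apply,
    roundingProb, ENNReal.ofReal_prod_of_nonneg]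
  · refine Finset.prod_congr rfl fun f _ => ?_
    have hcard : ∀ c : ℕ, (c : ENNReal) / ((D + D : ℕ) : ENNReal) =
        ENNReal.ofReal (c / (D + D)) := by
      intro c
      rw [ENNReal.ofReal_div_of_pos (by positivity), ENNReal.ofReal_natCast, ← Nat.cast_add,
        ENNReal.ofReal_natCast]
    rw [BlockHypergraph.keepProb_eq (hx0 f) (hx1 f)]
    by_cases hf : f ∈ K
    · have : {t | ∀ h : (f : ℕ) < m, a ⟨f, h⟩ ≤ t ↔ ⟨f, h⟩ ∈ K} = {t | a f ≤ t} := by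
        ext t; simp [hf]
      rw [this, toOuterMeasure_uniformBelow (by omega), if_pos hf]
      have : (Finset.range (D + D)).filter (fun t => a f ≤ t) = Finset.Ico (a f) (D + D) := by
        ext t; simp [and_comm]
      rw [this, Nat.card_Ico, hcard, Nat.cast_sub (by have := ha f; omega)]
      congr 1
      push_cast
      field_simp
      ring
    · have : {t | ∀ h : (f : ℕ) < m, a ⟨f, h⟩ ≤ t ↔ ⟨f, h⟩ ∈ K} = {t | t < a f} := by
        ext t; simp [hf]
      rw [this, toOuterMeasure_uniformBelow (by omega), if_neg hf]
      have : (Finset.range (D + D)).filter (fun t => t < a f) = Finset.range (a f) := by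
        ext t
        have := ha f
        simp only [Finset.mem_filter, Finset.mem_range]
        omega
      rw [this, Finset.card_range, hcard]
      congr 1
      field_simp
      ring
  · intro f _
    split_ifs
    · exact BlockHypergraph.keepProb_nonneg _ f
    · linarith [BlockHypergraph.keepProb_le_one (fun f => (a f : ℝ) / D) f]

/-- A program for the contention resolution scheme. -/
def schemeProgram : Program :=
  .seq (sampleProgram 6 (.add (.reg 3) (.reg 3)))
    (.seq (sampleProgram 7 (.add (.reg 4) (.const 1))) (.seq trimProgram selectProgram))

theorem run_schemeProgram (H : BlockHypergraph n r m) (D : ℕ) (a : Fin m → ℕ)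
    (A : Finset (Fin m)) : ∃ (F : (ℕ → ℕ) → (ℕ → ℕ) → State) (k : (ℕ → ℕ) → (ℕ → ℕ) → ℕ),
      (∀ κ ρ, k κ ρ ≤ 14 * m ^ 2 + 24 * m + 4) ∧
      (∀ κ ρ, output m (F κ ρ) =
        H.select (A ∩ Finset.univ.filter fun f : Fin m => a f ≤ κ f) ρ) ∧
      schemeProgram.run (initialState H D a A) =
        (sampleSeq (fun _ => uniformBelow (D + D)) m 0).bind fun κ =>
          (BlockHypergraph.rankLaw m).map fun ρ => (F κ ρ, k κ ρ) := by
  -- Once `κ` and `ρ` are fixed the remaining run is deterministic, so its final state and step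
  -- count are functions of the two samples.
  choose F k h1 h2 h3 using reaches_trim_select H D a A
  refine ⟨F, fun κ ρ => (m * 5 + 1) + ((m * 5 + 1) + k κ ρ), fun κ ρ => ?_, h3, ?_⟩
  · nlinarith [h2 κ ρ]
  · have r1 := run_sampleProgram 6 (.add (.reg 3) (.reg 3)) (initialState H D a A) rfl rfl
      (fun _ => D + D) (fun h i => rfl)
    have r2 : ∀ κ, (sampleProgram 7 (.add (.reg 4) (.const 1))).run
        ((initialState H D a A).withArr 6 κ) = (BlockHypergraph.rankLaw m).map fun ρ =>
          (((initialState H D a A).withArr 6 κ).withArr 7 ρ, m * 5 + 1) := fun κ =>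
      run_sampleProgram 7 (.add (.reg 4) (.const 1)) ((initialState H D a A).withArr 6 κ) rfl
        rfl (fun i => i + 1) (fun h i => rfl)
    have r3 : ∀ κ, (Program.seq (sampleProgram 7 (.add (.reg 4) (.const 1)))
        (.seq trimProgram selectProgram)).run ((initialState H D a A).withArr 6 κ) =
        (BlockHypergraph.rankLaw m).map fun ρ => (F κ ρ, (m * 5 + 1) + k κ ρ) := by
      intro κ
      rw [Program.run, r2, PMF.bind_map, ← PMF.bind_pure_comp]
      congr 1
      funext ρ
      simp only [Function.comp_apply, h1, PMF.pure_map]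
    rw [schemeProgram, Program.run, r1, PMF.bind_map]
    congr 1
    funext κ
    simp only [Function.comp_apply, r3, PMF.map_comp]
    rfl

theorem le_inputSize (n r m D : ℕ) (a : Fin m → ℕ) : m ≤ inputSize n r m D a := by
  unfold inputSize
  omega

theorem efficientlyComputable_scheme {b : ℝ} (hb0 : 0 < b) (hb1 : b ≤ 1) :
    EfficientlyComputable b fun n r m (H : BlockHypergraph n r m) => H.scheme := by
  refine ⟨schemeProgram, 14 * Polynomial.X ^ 2 + 24 * Polynomial.X + 4,
    fun n r m H D a A hD hx => ?_⟩
  obtain ⟨F, k, hk, hF, hrun⟩ := run_schemeProgram H D a A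
  rw [hrun]
  constructor
  · intro z hz
    simp only [PMF.mem_support_bind_iff, PMF.mem_support_map_iff] at hz
    obtain ⟨κ, -, ρ, -, rfl⟩ := hz
    refine (hk κ ρ).trans ?_
    have := le_inputSize n r m D a
    simp only [Polynomial.eval_add, Polynomial.eval_mul, Polynomial.eval_pow,
      Polynomial.eval_X, Polynomial.eval_ofNat]
    gcongr
  · have ha : ∀ f, a f ≤ D := by
      intro f
      have h := (le_of_mem_scaledBy hb0.le hx f).trans hb1
      rw [div_le_one (Nat.cast_pos.2 hD)] at h
      exact_mod_cast h
    simp only [BlockHypergraph.scheme]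
    rw [← sampleSeq_map_eq_roundingPMF hD a ha 0, PMF.bind_map,
      PMF.map_bind]
    congr 1
    funext κ
    rw [PMF.map_comp]
    simp only [Function.comp_apply]
    congr 1
    funext ρ
    exact hF κ ρ

end RandomRAM

theorem mainTheorem7 (b : ℝ) (hb0 : 0 < b) (hb1 : b ≤ 1) :
    ∃ π : ∀ n r m : ℕ, BlockHypergraph n r m →
        (Fin m → ℝ) → Finset (Fin m) → PMF (Finset (Fin m)),
      (∀ (n r m : ℕ) (H : BlockHypergraph n r m),
        IsMonotoneBalancedCRS H.IsMatching b
          (Real.exp (-b) * (1 - Real.exp (-b)) / b) (π n r m H)) ∧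
      RandomRAM.EfficientlyComputable b π :=
  ⟨fun _ _ _ H => H.scheme,
    fun _ _ _ H => BlockHypergraph.isMonotoneBalancedCRS_scheme hb0 hb1 H,
    RandomRAM.efficientlyComputable_scheme hb0 hb1⟩
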